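/- Let $\gamma_1,\gamma_2\ge 0$ with $\gamma_1+\gamma_2=1$, $P_1,P_2\in[0,1]$, $W>0$, and $0\le t_i'\le\gamma_i(1-P_i)$ for $i=1,2$. Put $$C=(t_1'+\gamma_1P_1)+W^2(t_2'+\gamma_2P_2),\qquad D_i=\gamma_i(1-P_i)-t_i'\quad(i=1,2),$$ $$g(x)=\frac{2}{\sqrt\pi}e^{-x^2},\qquad G(x)=\frac{2}{\sqrt\pi}\int_0^x e^{-y^2}\,dy,$$ and assume $C>0$ and $D_1+D_2>0$. Then the equation $$2C-\frac{g(x)D_1}{x\,G(x)}-\frac{W g(Wx)D_2}{x\,G(Wx)}=0$$ has exactly one solution $x_0$ in $(0,\infty)$, and the following holds. For a partition $\{1,\dots,n\}=K_1\sqcup K_2$ let $n_i=|K_i|$, $w_k=1$ for $k\in K_1$, $w_k=W$ for $k\in K_2$, and let $\mathrm{SP}=\{y\in\mathbb R^n:\sum_k w_k|y_k|\le 1\}$ be the skewed cross-polytope. For $L\subseteq\{1,\dots,n\}$ and signs $\sigma_k\in\{\pm1\}$ let $F_{L,\sigma}=\mathrm{conv}\{\sigma_k e_k/w_k: k\in L\}$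 be the corresponding face of $\mathrm{SP}$, and put $t_i=|L\cap K_i|-n_iP_i$. The external angle $\gamma(F,\mathrm{SP})$ of a face $F\ne\mathrm{SP}$ is the fraction of the unit sphere of the linear span of $c$ that is covered by $c$, where $c=\{u\in\mathbb R^n:\langle u,y\rangle\le\langle u,x\rangle\text{ for all }x\in F,\ y\in \mathrm{SP}\}$ is the cone of outward normals at $F$. For every sequence of such data $(n,K_1,K_2,L,\sigma)$ with $n\to\infty$, $n_i/n\to\gamma_i$ and $t_i/n\to t_i'$ for $i=1,2$ (in particular when $n_i=\gamma_i n$ and $t_i=t_i'n$ exactly), the external angle decays with exponent $$\lim\,-\frac1n\log\gamma(F_{L,\sigma},\mathrm{SP})=\psi_{\mathrm{ext}}:=Cx_0^2-D_1\log G(x_0)-D_2\log G(Wx_0).$$ -/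

import Mathlib

open Filter Topology MeasureTheory

noncomputable section

/-- The skewed cross-polytope `{y : ∑ wᵢ |yᵢ| ≤ 1}` in Euclidean space. -/
def skewedCrossPolytope {n : ℕ} (w : Fin n → ℝ) : Set (EuclideanSpace ℝ (Fin n)) :=
  {y | ∑ i, w i * |y i| ≤ 1}

/-- The face `conv {σᵢ eᵢ / wᵢ : i ∈ L}` of the skewed cross-polytope, supported on `L`
and with sign pattern `σ`. -/
def skewedFace {n : ℕ} (w : Fin n → ℝ) (L : Finset (Fin n)) (σ : Fin n → ℤˣ) :
    Set (EuclideanSpace ℝ (Fin n)) :=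
  convexHull ℝ ((fun i => EuclideanSpace.single i (((σ i : ℤ) : ℝ) / w i)) '' (L : Set (Fin n)))

/-- The cone of outward normals `u` to the hyperplanes that support `P` at `F`: the linear
functional `⟪u, ·⟫` attains its maximum over `P` at every point of `F`. -/
def outwardNormalCone {n : ℕ} (F P : Set (EuclideanSpace ℝ (Fin n))) :
    Set (EuclideanSpace ℝ (Fin n)) :=
  {u | ∀ x ∈ F, ∀ y ∈ P, inner ℝ u y ≤ inner ℝ u x}

/-- The surface measure of the unit sphere of a linear subspace `V`, induced by the Euclidean
volume of `V` itself (normalised on an orthonormal basis of `V`, not the restriction of the volume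
of the ambient space). -/
def subspaceSphereMeasure {n : ℕ} (V : Submodule ℝ (EuclideanSpace ℝ (Fin n))) :
    Measure (Metric.sphere (0 : V) 1) :=
  (volume : Measure V).toSphere

/-- The fraction of the unit sphere (of the linear span of `c`) that is covered by the cone `c`. -/
def sphereFraction {n : ℕ} (c : Set (EuclideanSpace ℝ (Fin n))) : ℝ :=
  (subspaceSphereMeasure (Submodule.span ℝ c)).real
      {u | ((u : Submodule.span ℝ c) : EuclideanSpace ℝ (Fin n)) ∈ c} /
    (subspaceSphereMeasure (Submodule.span ℝ c)).real Set.univ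

open Classical in
/-- The external angle `γ(F, P)`: the fraction of the sphere covered by the cone of outward
normals, with the conventions `γ(F, F) = 1` and `γ(F, P) = 0` if `F ⊈ P`. -/
def externalAngle {n : ℕ} (F P : Set (EuclideanSpace ℝ (Fin n))) : ℝ :=
  if F = P then 1 else if F ⊆ P then sphereFraction (outwardNormalCone F P) else 0

/-- The weights: `1` on `K₁` and `W` on the complement of `K₁`. -/
def twoWeights {n : ℕ} (K₁ : Finset (Fin n)) (W : ℝ) (i : Fin n) : ℝ :=
  if i ∈ K₁ then 1 else W

/-- The normalized error function `G(x) = (2/√π) ∫₀ˣ exp(-y²) dy`. -/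
def erfG (x : ℝ) : ℝ := 2 / √Real.pi * ∫ y in (0 : ℝ)..x, Real.exp (-y ^ 2)

/-- The density `g(x) = (2/√π) exp(-x²)` of `erfG`. -/
def erfDensity (x : ℝ) : ℝ := 2 / √Real.pi * Real.exp (-x ^ 2)

end

/-! A rotation-invariant measure sees only the solid angle of a cone, so the external angle is the
share of the mass of exp(-‖u‖²) on the span of the normal cone that lies in the cone
(`sphereFraction_eq_gaussian`). A normal vector at the face has the form u_k = σ_k w_k s on L with s
≥ 0, and its other coordinates are constrained only by |u_k| ≤ w_k s (`mem_outwardNormalCone_iff`).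
For fixed s the Gaussian mass is therefore that of a box and factors into error functions. With A =
∑_{k ∈ L} w_k², this leaves the single integral √(A/π) ∫ exp(-A s²) ∏_{k ∉ L} G(w_k s) ds
(`externalAngle_skewedFace`).

When A and the two numbers of factors grow linearly in n, the integrand is roughly exp(-n φ(s)) with
φ = `erfExponent C D₁ D₂ W`, and Laplace's method gives the exponent min φ
(`tendsto_log_gaussianErfIntegral`). The derivative is φ'(x) = x (2C - R(x)), where R = `saddleRatio
D₁ D₂ W` decreases strictly from ∞ to 0. Hence R = 2C has exactly one root x₀, and φ is minimal
there (`erfExponent_le_of_saddleRatio_eq`). -/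

/-! ### The error function -/

lemma continuous_exp_neg_sq : Continuous fun y : ℝ => Real.exp (-y ^ 2) := by fun_prop

lemma hasDerivAt_erfG (x : ℝ) : HasDerivAt erfG (erfDensity x) x := by
  have h := (continuous_exp_neg_sq.integral_hasStrictDerivAt 0 x).hasDerivAt
  exact h.const_mul _

lemma erfDensity_pos (x : ℝ) : 0 < erfDensity x := by
  unfold erfDensity; positivity

lemma continuous_erfDensity : Continuous erfDensity := by
  unfold erfDensity; fun_prop

lemma continuous_erfG : Continuous erfG :=
  continuous_iff_continuousAt.2 fun x => (hasDerivAt_erfG x).continuousAt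

lemma strictMono_erfG : StrictMono erfG :=
  strictMono_of_deriv_pos fun x => by
    rw [(hasDerivAt_erfG x).deriv]; exact erfDensity_pos x

@[simp] lemma erfG_zero : erfG 0 = 0 := by simp [erfG]

lemma erfG_pos {x : ℝ} (hx : 0 < x) : 0 < erfG x := by
  simpa using strictMono_erfG hx

lemma erfG_nonneg {x : ℝ} (hx : 0 ≤ x) : 0 ≤ erfG x := by
  simpa using strictMono_erfG.monotone hx

lemma integrable_exp_neg_sq : Integrable fun y : ℝ => Real.exp (-y ^ 2) := by
  simpa using integrable_exp_neg_mul_sq (b := 1) one_pos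

lemma erfG_le_one {x : ℝ} (hx : 0 ≤ x) : erfG x ≤ 1 := by
  have h1 : ∫ y in (0 : ℝ)..x, Real.exp (-y ^ 2) ≤ √Real.pi / 2 := by
    have h2 := integral_gaussian_Ioi 1
    simp only [div_one] at h2
    rw [← h2, intervalIntegral.integral_of_le hx]
    simp only [neg_mul, one_mul]
    exact setIntegral_mono_set integrable_exp_neg_sq.integrableOn
      (Eventually.of_forall fun y => (Real.exp_pos _).le)
      (Eventually.of_forall fun y hy => hy.1)
  have hp : 0 < √Real.pi := Real.sqrt_pos.2 Real.pi_pos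
  calc erfG x ≤ 2 / √Real.pi * (√Real.pi / 2) := by unfold erfG; gcongr
    _ = 1 := by field_simp

lemma log_erfG_nonpos {x : ℝ} (hx : 0 ≤ x) : Real.log (erfG x) ≤ 0 :=
  Real.log_nonpos (erfG_nonneg hx) (erfG_le_one hx)

lemma erfDensity_le_of_le {x y : ℝ} (hx : 0 ≤ x) (hxy : x ≤ y) :
    erfDensity y ≤ erfDensity x := by
  unfold erfDensity; gcongr

/-! ### The saddle point equation and the minimum of the exponent -/

/-- The ratio `g(x) / (x G(x))`. -/
noncomputable def erfRatio (x : ℝ) : ℝ := erfDensity x / (x * erfG x)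

lemma erfRatio_pos {x : ℝ} (hx : 0 < x) : 0 < erfRatio x :=
  div_pos (erfDensity_pos x) (mul_pos hx (erfG_pos hx))

lemma erfRatio_strictAntiOn : StrictAntiOn erfRatio (Set.Ioi 0) := by
  intro x hx y hy hxy
  have hx : 0 < x := hx
  have hG := strictMono_erfG hxy
  have hGx := erfG_pos hx
  exact div_lt_div₀' (erfDensity_le_of_le hx.le hxy.le) (by nlinarith) (erfDensity_pos x)
    (mul_pos hx hGx)

lemma continuousOn_erfRatio : ContinuousOn erfRatio (Set.Ioi 0) :=
  continuous_erfDensity.continuousOn.div (by have := continuous_erfG; fun_prop) fun x hx =>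
    (mul_pos (Set.mem_Ioi.1 hx) (erfG_pos hx)).ne'

lemma tendsto_erfRatio_nhdsGT : Tendsto erfRatio (𝓝[>] 0) atTop := by
  have h1 : Tendsto erfDensity (𝓝[>] 0) (𝓝 (erfDensity 0)) :=
    continuous_erfDensity.continuousAt.mono_left nhdsWithin_le_nhds
  have hc : Continuous fun x => x * erfG x := continuous_id.mul continuous_erfG
  have h2 : Tendsto (fun x => x * erfG x) (𝓝[>] 0) (𝓝[>] 0) := by
    refine tendsto_nhdsWithin_iff.2 ⟨?_, ?_⟩
    · simpa using (hc.tendsto 0).mono_left nhdsWithin_le_nhds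
    · filter_upwards [self_mem_nhdsWithin] with x hx
      exact mul_pos hx (erfG_pos hx)
  exact h1.pos_mul_atTop (erfDensity_pos 0) (tendsto_inv_nhdsGT_zero.comp h2)

lemma tendsto_erfRatio_atTop : Tendsto erfRatio atTop (𝓝 0) := by
  -- A majorant for x ≥ 1, from g(x) ≤ g(0) and G(x) ≥ G(1).
  have h2 : Tendsto (fun x : ℝ => erfDensity 0 / (x * erfG 1)) atTop (𝓝 0) :=
    tendsto_const_nhds.div_atTop (tendsto_id.atTop_mul_const (erfG_pos one_pos))
  refine squeeze_zero' ?_ ?_ h2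
  · filter_upwards [eventually_gt_atTop 0] with x hx using (erfRatio_pos hx).le
  · filter_upwards [eventually_ge_atTop 1] with x hx
    have h3 := strictMono_erfG.monotone hx
    have h4 := erfG_pos one_pos
    have h5 := erfDensity_le_of_le le_rfl (zero_le_one.trans hx)
    have h6 := (erfDensity_pos 0).le
    unfold erfRatio
    gcongr

/-- The combination `D₁ g(x) / (x G(x)) + D₂ W g(W x) / (x G(W x))`. -/
noncomputable def saddleRatio (D₁ D₂ W x : ℝ) : ℝ :=
  -- The square compensates for the extra W in the denominator of `erfRatio (W * x)`.
  D₁ * erfRatio x + D₂ * W ^ 2 * erfRatio (W * x)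

lemma saddleRatio_strictAntiOn {D₁ D₂ W : ℝ} (hW : 0 < W) (h₁ : 0 ≤ D₁) (h₂ : 0 ≤ D₂)
    (hD : 0 < D₁ + D₂) : StrictAntiOn (saddleRatio D₁ D₂ W) (Set.Ioi 0) := by
  intro x hx y hy hxy
  have hx : 0 < x := hx
  have hy : 0 < y := hy
  have e1 := erfRatio_strictAntiOn hx hy hxy
  have e2 := erfRatio_strictAntiOn (mul_pos hW hx) (mul_pos hW hy)
    (mul_lt_mul_of_pos_left hxy hW)
  have hW2 : 0 < W ^ 2 := by positivity
  unfold saddleRatio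
  -- Only one of the two coefficients need be positive; strictness comes from that term.
  rcases h₁.eq_or_lt with rfl | h₁
  · have : 0 < D₂ := by linarith
    have := mul_lt_mul_of_pos_left e2 (mul_pos this hW2)
    linarith
  · have := mul_lt_mul_of_pos_left e1 h₁
    have := mul_le_mul_of_nonneg_left e2.le (mul_nonneg h₂ hW2.le)
    linarith

lemma continuousOn_saddleRatio (D₁ D₂ : ℝ) {W : ℝ} (hW : 0 < W) :
    ContinuousOn (saddleRatio D₁ D₂ W) (Set.Ioi 0) := by
  have h : ContinuousOn (fun x => erfRatio (W * x)) (Set.Ioi 0) :=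
    continuousOn_erfRatio.comp (by fun_prop) fun x hx => mul_pos hW hx
  exact (continuousOn_const.mul continuousOn_erfRatio).add (continuousOn_const.mul h)

lemma tendsto_saddleRatio_nhdsGT {D₁ D₂ W : ℝ} (hW : 0 < W) (h₁ : 0 ≤ D₁) (h₂ : 0 ≤ D₂)
    (hD : 0 < D₁ + D₂) : Tendsto (saddleRatio D₁ D₂ W) (𝓝[>] 0) atTop := by
  have hWx : Tendsto (fun x => W * x) (𝓝[>] (0 : ℝ)) (𝓝[>] 0) := by
    refine tendsto_nhdsWithin_iff.2 ⟨?_, ?_⟩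
    · have hc : Continuous fun x : ℝ => W * x := by fun_prop
      simpa using (hc.tendsto 0).mono_left nhdsWithin_le_nhds
    · filter_upwards [self_mem_nhdsWithin] with x hx using mul_pos hW hx
  have hW2 : 0 < W ^ 2 := by positivity
  rcases h₁.eq_or_lt with rfl | h₁
  · have : 0 < D₂ := by linarith
    unfold saddleRatio
    simp only [zero_mul, zero_add]
    exact (tendsto_erfRatio_nhdsGT.comp hWx).const_mul_atTop (mul_pos this hW2)
  · refine tendsto_atTop_mono' _ ?_ (tendsto_erfRatio_nhdsGT.const_mul_atTop h₁)
    filter_upwards [self_mem_nhdsWithin] with x hx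
    have := mul_nonneg (mul_nonneg h₂ hW2.le) (erfRatio_pos (mul_pos hW hx)).le
    unfold saddleRatio
    linarith

lemma tendsto_saddleRatio_atTop (D₁ D₂ : ℝ) {W : ℝ} (hW : 0 < W) :
    Tendsto (saddleRatio D₁ D₂ W) atTop (𝓝 0) := by
  have h := tendsto_erfRatio_atTop.comp (tendsto_id.const_mul_atTop hW)
  unfold saddleRatio
  simpa using (tendsto_erfRatio_atTop.const_mul D₁).add (h.const_mul (D₂ * W ^ 2))

lemma exists_saddleRatio_eq {D₁ D₂ W c : ℝ} (hW : 0 < W) (h₁ : 0 ≤ D₁) (h₂ : 0 ≤ D₂)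
    (hD : 0 < D₁ + D₂) (hc : 0 < c) : ∃ x₀, 0 < x₀ ∧ saddleRatio D₁ D₂ W x₀ = c := by
  obtain ⟨a, ha, ha0⟩ := (((tendsto_saddleRatio_nhdsGT hW h₁ h₂ hD).eventually_ge_atTop c).and
    self_mem_nhdsWithin).exists
  obtain ⟨b, hb, hb0⟩ := (((tendsto_saddleRatio_atTop D₁ D₂ hW).eventually_le_const hc).and
    (eventually_gt_atTop 0)).exists
  obtain ⟨x₀, hx, h⟩ := isPreconnected_Ioi.intermediate_value hb0 ha0
    (continuousOn_saddleRatio D₁ D₂ hW) ⟨hb, ha⟩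
  exact ⟨x₀, hx, h⟩

/-- The exponent `C x² - D₁ log G(x) - D₂ log G(W x)`. -/
noncomputable def erfExponent (C D₁ D₂ W x : ℝ) : ℝ :=
  C * x ^ 2 - D₁ * Real.log (erfG x) - D₂ * Real.log (erfG (W * x))

/-- Pulling out the factor x leaves a bracket that increases strictly when D₁, D₂ ≥ 0 are not both
zero, so the sign of the derivative can be read off from the root of the bracket. -/
lemma hasDerivAt_erfExponent (C D₁ D₂ : ℝ) {W x : ℝ} (hW : 0 < W) (hx : 0 < x) :
    HasDerivAt (erfExponent C D₁ D₂ W) (x * (2 * C - saddleRatio D₁ D₂ W x)) x := by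
  have hG := erfG_pos hx
  have hWx := mul_pos hW hx
  have hG' := erfG_pos hWx
  have e1 := ((hasDerivAt_erfG x).log hG.ne').const_mul D₁
  have e2 := ((((hasDerivAt_erfG (W * x)).comp x ((hasDerivAt_id x).const_mul W))).log
    hG'.ne').const_mul D₂
  have e3 := ((((hasDerivAt_id x).pow 2).const_mul C).sub e1).sub e2
  refine e3.congr_deriv ?_
  simp only [saddleRatio, erfRatio, id, Function.comp]
  field_simp
  push_cast
  ring

/-- The derivative is nonpositive before x₀ and nonnegative after it, because the saddle ratio is
decreasing. -/
lemma erfExponent_le_of_saddleRatio_eq {C D₁ D₂ W x₀ x : ℝ} (hW : 0 < W) (h₁ : 0 ≤ D₁)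
    (h₂ : 0 ≤ D₂) (hD : 0 < D₁ + D₂) (hx₀ : 0 < x₀) (h : saddleRatio D₁ D₂ W x₀ = 2 * C)
    (hx : 0 < x) : erfExponent C D₁ D₂ W x₀ ≤ erfExponent C D₁ D₂ W x := by
  have anti := (saddleRatio_strictAntiOn hW h₁ h₂ hD).antitoneOn
  have hd := fun y (hy : 0 < y) => hasDerivAt_erfExponent C D₁ D₂ hW hy
  rcases le_total x x₀ with hxx | hxx
  · refine antitoneOn_of_deriv_nonpos (convex_Icc x x₀)
      (fun y hy => (hd y (hx.trans_le hy.1)).continuousAt.continuousWithinAt)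
      (fun y hy => ?_) (fun y hy => ?_) ⟨le_rfl, hxx⟩ ⟨hxx, le_rfl⟩ hxx
    · rw [interior_Icc] at hy
      exact (hd y (hx.trans hy.1)).differentiableAt.differentiableWithinAt
    · rw [interior_Icc] at hy
      have hy0 := hx.trans hy.1
      rw [(hd y hy0).deriv]
      have := anti hy0 hx₀ hy.2.le
      exact mul_nonpos_of_nonneg_of_nonpos hy0.le (by linarith)
  · refine monotoneOn_of_deriv_nonneg (convex_Icc x₀ x)
      (fun y hy => (hd y (hx₀.trans_le hy.1)).continuousAt.continuousWithinAt)
      (fun y hy => ?_) (fun y hy => ?_) ⟨le_rfl, hxx⟩ ⟨hxx, le_rfl⟩ hxx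
    · rw [interior_Icc] at hy
      exact (hd y (hx₀.trans hy.1)).differentiableAt.differentiableWithinAt
    · rw [interior_Icc] at hy
      have hy0 := hx₀.trans hy.1
      rw [(hd y hy0).deriv]
      have := anti hx₀ hy0 hy.1.le
      exact mul_nonneg hy0.le (by linarith)

/-! ### Laplace's method for the one-dimensional integral -/

/-- The one-dimensional integral `√(A/π) ∫₀^∞ exp(-A s²) G(s)^d₁ G(W s)^d₂ ds`. -/
noncomputable def gaussianErfIntegral (A W : ℝ) (d₁ d₂ : ℕ) : ℝ :=
  √(A / Real.pi) *
    ∫ s in Set.Ioi (0 : ℝ), Real.exp (-A * s ^ 2) * (erfG s ^ d₁ * erfG (W * s) ^ d₂)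

lemma exp_mul_erfG_pow_eq {A W s : ℝ} (d₁ d₂ : ℕ) (hW : 0 < W) (hs : 0 < s) :
    Real.exp (-A * s ^ 2) * (erfG s ^ d₁ * erfG (W * s) ^ d₂) =
      Real.exp (-erfExponent A d₁ d₂ W s) := by
  have e1 : erfG s ^ d₁ = Real.exp (d₁ * Real.log (erfG s)) := by
    rw [Real.exp_nat_mul, Real.exp_log (erfG_pos hs)]
  have e2 : erfG (W * s) ^ d₂ = Real.exp (d₂ * Real.log (erfG (W * s))) := by
    rw [Real.exp_nat_mul, Real.exp_log (erfG_pos (mul_pos hW hs))]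
  rw [e1, e2, ← Real.exp_add, ← Real.exp_add]
  unfold erfExponent
  ring_nf

lemma exp_mul_erfG_pow_le {A W s : ℝ} (d₁ d₂ : ℕ) (hW : 0 < W) (hs : 0 < s) :
    Real.exp (-A * s ^ 2) * (erfG s ^ d₁ * erfG (W * s) ^ d₂) ≤ Real.exp (-A * s ^ 2) := by
  have hWs := mul_pos hW hs
  have e1 := pow_le_one₀ (n := d₁) (erfG_nonneg hs.le) (erfG_le_one hs.le)
  have e2 := pow_le_one₀ (n := d₂) (erfG_nonneg hWs.le) (erfG_le_one hWs.le)
  exact mul_le_of_le_one_right (Real.exp_pos _).le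
    (mul_le_one₀ e1 (pow_nonneg (erfG_nonneg hWs.le) _) e2)

lemma exp_mul_erfG_pow_nonneg {A W s : ℝ} (d₁ d₂ : ℕ) (hW : 0 < W) (hs : 0 < s) :
    0 ≤ Real.exp (-A * s ^ 2) * (erfG s ^ d₁ * erfG (W * s) ^ d₂) := by
  rw [exp_mul_erfG_pow_eq d₁ d₂ hW hs]; positivity

lemma integrableOn_exp_mul_erfG_pow {A W : ℝ} (d₁ d₂ : ℕ) (hA : 0 < A) (hW : 0 < W) :
    IntegrableOn (fun s => Real.exp (-A * s ^ 2) * (erfG s ^ d₁ * erfG (W * s) ^ d₂))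
      (Set.Ioi 0) := by
  have hc : Continuous fun s => Real.exp (-A * s ^ 2) * (erfG s ^ d₁ * erfG (W * s) ^ d₂) := by
    have := continuous_erfG
    fun_prop
  refine (integrable_exp_neg_mul_sq hA).integrableOn.mono' hc.aestronglyMeasurable ?_
  filter_upwards [ae_restrict_mem measurableSet_Ioi] with s hs
  rw [Real.norm_of_nonneg (exp_mul_erfG_pow_nonneg d₁ d₂ hW hs)]
  exact exp_mul_erfG_pow_le d₁ d₂ hW hs

/-- Restrict to (x, x + δ] and take each factor at its worse endpoint: the exponential at the right
end, the increasing powers of G at the left end. -/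
lemma le_integral_exp_mul_erfG_pow {A W x δ : ℝ} (d₁ d₂ : ℕ) (hA : 0 < A) (hW : 0 < W)
    (hx : 0 < x) (hδ : 0 < δ) :
    δ * (Real.exp (-A * (x + δ) ^ 2) * (erfG x ^ d₁ * erfG (W * x) ^ d₂)) ≤
      ∫ s in Set.Ioi (0 : ℝ), Real.exp (-A * s ^ 2) * (erfG s ^ d₁ * erfG (W * s) ^ d₂) := by
  have hint := integrableOn_exp_mul_erfG_pow d₁ d₂ hA hW
  have hsub : Set.Ioc x (x + δ) ⊆ Set.Ioi 0 := fun y hy => hx.trans hy.1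
  calc δ * (Real.exp (-A * (x + δ) ^ 2) * (erfG x ^ d₁ * erfG (W * x) ^ d₂))
      = ∫ _ in Set.Ioc x (x + δ),
          Real.exp (-A * (x + δ) ^ 2) * (erfG x ^ d₁ * erfG (W * x) ^ d₂) := by
        simp [hδ.le]
    _ ≤ ∫ s in Set.Ioc x (x + δ),
          Real.exp (-A * s ^ 2) * (erfG s ^ d₁ * erfG (W * s) ^ d₂) := by
        refine setIntegral_mono_on (integrableOn_const (by simp)) (hint.mono_set hsub)
          measurableSet_Ioc fun s hs => ?_
        have hs0 : 0 < s := hx.trans hs.1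
        have e1 := erfG_nonneg hx.le
        have e2 := erfG_nonneg (mul_pos hW hx).le
        have e3 := erfG_nonneg hs0.le
        have e4 : s ^ 2 ≤ (x + δ) ^ 2 := pow_le_pow_left₀ hs0.le hs.2 2
        have e5 := strictMono_erfG.monotone hs.1.le
        have e6 := strictMono_erfG.monotone (mul_le_mul_of_nonneg_left hs.1.le hW.le)
        refine mul_le_mul (Real.exp_le_exp.2 (by nlinarith)) ?_ (by positivity) (by positivity)
        gcongr
    _ ≤ _ := by
        refine setIntegral_mono_set hint ?_ hsub.eventuallyLE
        filter_upwards [ae_restrict_mem measurableSet_Ioi] with s hs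
        exact exp_mul_erfG_pow_nonneg d₁ d₂ hW hs

/-- Since log G ≤ 0, the hypotheses make the exponent of the integrand at least N φ(s), with φ =
`erfExponent C D₁ D₂ W`. Of the N copies of φ, N - 1 are bounded below by ψ; the last is bounded
below by C s², which keeps an integrable factor independent of N. -/
lemma integral_exp_mul_erfG_pow_le {A C D₁ D₂ W ψ N : ℝ} (d₁ d₂ : ℕ) (hA : 0 < A) (hC : 0 < C)
    (h₁ : 0 ≤ D₁) (h₂ : 0 ≤ D₂) (hW : 0 < W) (hN : 1 ≤ N) (hAN : N * C ≤ A) (hd₁ : N * D₁ ≤ d₁)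
    (hd₂ : N * D₂ ≤ d₂) (hψ : ∀ s, 0 < s → ψ ≤ erfExponent C D₁ D₂ W s) :
    ∫ s in Set.Ioi (0 : ℝ), Real.exp (-A * s ^ 2) * (erfG s ^ d₁ * erfG (W * s) ^ d₂) ≤
      Real.exp (-((N - 1) * ψ)) * ∫ s in Set.Ioi (0 : ℝ), Real.exp (-C * s ^ 2) := by
  rw [← integral_const_mul]
  refine setIntegral_mono_on (integrableOn_exp_mul_erfG_pow d₁ d₂ hA hW)
    ((integrable_exp_neg_mul_sq hC).integrableOn.const_mul _) measurableSet_Ioi fun s hs => ?_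
  have hs : 0 < s := hs
  rw [exp_mul_erfG_pow_eq d₁ d₂ hW hs, ← Real.exp_add, Real.exp_le_exp]
  have l1 := log_erfG_nonpos hs.le
  have l2 := log_erfG_nonpos (mul_pos hW hs).le
  have m0 : N * C * s ^ 2 ≤ A * s ^ 2 := by gcongr
  have m1 := mul_le_mul_of_nonpos_right hd₁ l1
  have m2 := mul_le_mul_of_nonpos_right hd₂ l2
  have m3 := mul_le_mul_of_nonneg_left (hψ s hs) (sub_nonneg.2 hN)
  have m4 := mul_nonpos_of_nonneg_of_nonpos h₁ l1
  have m5 := mul_nonpos_of_nonneg_of_nonpos h₂ l2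
  unfold erfExponent at *
  linarith

lemma tendsto_log_div_self_comp {n : ℕ → ℕ} (hn : Tendsto n atTop atTop) :
    Tendsto (fun j => Real.log (n j) / n j) atTop (𝓝 0) := by
  have h : Tendsto (fun x : ℝ => Real.log x / x) atTop (𝓝 0) := by
    simpa using Real.isLittleO_log_id_atTop.tendsto_div_nhds_zero
  exact h.comp (tendsto_natCast_atTop_atTop.comp hn)

/-- Laplace asymptotics of `gaussianErfIntegral` for proportionally growing parameters. -/
theorem tendsto_log_gaussianErfIntegral {C D₁ D₂ W x₀ : ℝ} (hC : 0 < C) (h₁ : 0 ≤ D₁)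
    (h₂ : 0 ≤ D₂) (hW : 0 < W) (hx₀ : 0 < x₀)
    (hmin : ∀ s, 0 < s → erfExponent C D₁ D₂ W x₀ ≤ erfExponent C D₁ D₂ W s)
    {n d₁ d₂ : ℕ → ℕ} {A : ℕ → ℝ} (hn : Tendsto n atTop atTop)
    (hA : Tendsto (fun j => A j / n j) atTop (𝓝 C))
    (hd₁ : Tendsto (fun j => (d₁ j : ℝ) / n j) atTop (𝓝 D₁))
    (hd₂ : Tendsto (fun j => (d₂ j : ℝ) / n j) atTop (𝓝 D₂)) :
    Tendsto (fun j => -(Real.log (gaussianErfIntegral (A j) W (d₁ j) (d₂ j)) / n j)) atTop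
      (𝓝 (erfExponent C D₁ D₂ W x₀)) := by
  set ψ := erfExponent C D₁ D₂ W x₀ with hψ
  have hnR : Tendsto (fun j => (n j : ℝ)) atTop atTop := tendsto_natCast_atTop_atTop.comp hn
  have hinv : Tendsto (fun j => (n j : ℝ)⁻¹) atTop (𝓝 0) := tendsto_inv_atTop_zero.comp hnR
  have hlog := tendsto_log_div_self_comp hn
  have hn0 : ∀ᶠ j in atTop, 0 < (n j : ℝ) := hnR.eventually_gt_atTop 0
  have hA0 : ∀ᶠ j in atTop, 0 < A j := by
    filter_upwards [hA.eventually_const_lt hC, hn0] with j hj hj'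
    exact (div_pos_iff_of_pos_right hj').1 hj
  set S : ℕ → ℝ := fun j => Real.log (√(A j / Real.pi)) / n j with hS
  -- The prefactor is of polynomial size because A grows linearly in n, so its logarithm is O(log
  -- n).
  have hSlim : Tendsto S atTop (𝓝 0) := by
    have hl : Tendsto (fun j => Real.log (A j / n j)) atTop (𝓝 (Real.log C)) :=
      hA.log hC.ne'
    have h3 : Tendsto (fun j => (Real.log (A j / n j) * (n j : ℝ)⁻¹ + Real.log (n j) / n j -
        Real.log Real.pi * (n j : ℝ)⁻¹) / 2) atTop (𝓝 0) := by
      simpa using (((hl.mul hinv).add hlog).sub (hinv.const_mul (Real.log Real.pi))).div_const 2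
    refine h3.congr' ?_
    filter_upwards [hn0, hA0] with j hj hAj
    simp only [hS]
    rw [Real.log_sqrt (by positivity), Real.log_div hAj.ne' Real.pi_ne_zero,
      Real.log_div hAj.ne' hj.ne']
    field_simp
    ring
  have hI0 : ∀ᶠ j in atTop, 0 < ∫ s in Set.Ioi (0 : ℝ),
      Real.exp (-A j * s ^ 2) * (erfG s ^ d₁ j * erfG (W * s) ^ d₂ j) := by
    filter_upwards [hA0] with j hj
    refine lt_of_lt_of_le ?_ (le_integral_exp_mul_erfG_pow (d₁ j) (d₂ j) hj hW hx₀ one_pos)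
    have := erfG_pos hx₀
    have := erfG_pos (mul_pos hW hx₀)
    positivity
  have hγ : ∀ᶠ j in atTop, -(Real.log (gaussianErfIntegral (A j) W (d₁ j) (d₂ j)) / n j) =
      -S j - Real.log (∫ s in Set.Ioi (0 : ℝ),
      Real.exp (-A j * s ^ 2) * (erfG s ^ d₁ j * erfG (W * s) ^ d₂ j)) / n j := by
    filter_upwards [hA0, hI0] with j hj hI
    rw [gaussianErfIntegral, Real.log_mul (by positivity) hI.ne', hS]
    ring
  refine tendsto_order.2 ⟨fun a ha => ?_, fun b hb => ?_⟩
  · set J := ∫ s in Set.Ioi (0 : ℝ), Real.exp (-C * s ^ 2) with hJ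
    have hJ0 : 0 < J := by
      rw [hJ, integral_gaussian_Ioi]; positivity
    -- The upper bound cannot be used with N = n, since A/n and d_i/n may approach their limits from
    -- below. Taking N = r n with r < 1 gives the needed slack, and r is close enough to 1 to keep r
    -- ψ above a.
    obtain ⟨r, hr1, hr0, har⟩ : ∃ r : ℝ, r < 1 ∧ 0 < r ∧ a < r * ψ := by
      have hlim : Tendsto (fun r : ℝ => r * ψ) (𝓝[<] 1) (𝓝 ψ) := by
        have hc : Continuous fun r : ℝ => r * ψ := by fun_prop
        simpa using (hc.tendsto 1).mono_left nhdsWithin_le_nhds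
      obtain ⟨r, hr⟩ := ((hlim.eventually_const_lt ha).and (Ioo_mem_nhdsLT (zero_lt_one' ℝ))).exists
      exact ⟨r, hr.2.2, hr.2.1, hr.1⟩
    have ev : ∀ {D : ℝ} {d : ℕ → ℝ}, 0 ≤ D → (∀ᶠ j in atTop, 0 ≤ d j) →
        Tendsto (fun j => d j / n j) atTop (𝓝 D) → ∀ᶠ j in atTop, (n j * r) * D ≤ d j := by
      intro D d hD hd hlim
      -- For D = 0 there is no slack to gain, but nonnegativity of d suffices.
      rcases hD.eq_or_lt with rfl | hD
      · simpa using hd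
      · have : r * D < D := by nlinarith
        filter_upwards [hlim.eventually_const_lt this, hn0] with j hj hj'
        rw [lt_div_iff₀ hj'] at hj
        linarith
    have hlow : Tendsto (fun j => -S j + (r - (n j : ℝ)⁻¹) * ψ - Real.log J * (n j : ℝ)⁻¹) atTop
        (𝓝 (r * ψ)) := by
      simpa using (hSlim.neg.add ((hinv.const_sub r).mul_const ψ)).sub (hinv.const_mul (Real.log J))
    filter_upwards [hγ, hlow.eventually_const_lt har, hn0, hA0, hI0,
      ev hC.le (hA0.mono fun _ h => h.le) hA, ev h₁ (Eventually.of_forall fun _ => by positivity) hd₁,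
      ev h₂ (Eventually.of_forall fun _ => by positivity) hd₂,
      (hnR.atTop_mul_const hr0).eventually_ge_atTop 1] with j e1 e2 e3 e4 e5 e6 e7 e8 e9
    rw [e1]
    refine e2.trans_le ?_
    have hle := integral_exp_mul_erfG_pow_le (d₁ j) (d₂ j) e4 hC h₁ h₂ hW e9 e6 e7 e8 hmin
    have hll := Real.log_le_log e5 hle
    rw [Real.log_mul (Real.exp_pos _).ne' hJ0.ne', Real.log_exp] at hll
    have := div_le_div_of_nonneg_right hll e3.le
    have e10 : (-((n j * r - 1) * ψ) + Real.log J) / n j =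
      -((r - (n j : ℝ)⁻¹) * ψ) + Real.log J * (n j : ℝ)⁻¹ := by field_simp
    linarith
  -- The window starts at x₀ and has width δ = 1/n. Its width costs log n and its right end differs
  -- from x₀ by 1/n, both negligible after division by n.
  · have hup : Tendsto (fun j => -S j + Real.log (n j) / n j + (A j / n j * (x₀ + (n j : ℝ)⁻¹) ^ 2
        - d₁ j / n j * Real.log (erfG x₀) - d₂ j / n j * Real.log (erfG (W * x₀)))) atTop
        (𝓝 ψ) := by
      have := (hSlim.neg.add hlog).add (((hA.mul ((hinv.const_add x₀).pow 2)).sub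
        (hd₁.mul_const (Real.log (erfG x₀)))).sub (hd₂.mul_const (Real.log (erfG (W * x₀)))))
      simpa [hψ, erfExponent] using this
    filter_upwards [hγ, hup.eventually_lt_const hb, hn0, hA0, hI0] with j e1 e2 e3 e4 e5
    rw [e1]
    refine lt_of_le_of_lt ?_ e2
    have hle := le_integral_exp_mul_erfG_pow (d₁ j) (d₂ j) e4 hW hx₀ (inv_pos.2 e3)
    have g1 := erfG_pos hx₀
    have g2 := erfG_pos (mul_pos hW hx₀)
    have hll := Real.log_le_log (by positivity) hle
    rw [Real.log_mul (by positivity) (by positivity), Real.log_mul (by positivity) (by positivity),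
      Real.log_mul (by positivity) (by positivity), Real.log_exp, Real.log_inv, Real.log_pow,
      Real.log_pow] at hll
    have := div_le_div_of_nonneg_right hll e3.le
    have e10 : (-Real.log (n j) + (-A j * (x₀ + (n j : ℝ)⁻¹) ^ 2 + (d₁ j * Real.log (erfG x₀)
        + d₂ j * Real.log (erfG (W * x₀))))) / n j = -(Real.log (n j) / n j +
        (A j / n j * (x₀ + (n j : ℝ)⁻¹) ^ 2
        - d₁ j / n j * Real.log (erfG x₀) - d₂ j / n j * Real.log (erfG (W * x₀)))) := by
      ring
    linarith

/-! ### Gaussian mass of a cone in polar coordinates -/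

section Polar

variable {E : Type*} [NormedAddCommGroup E] [NormedSpace ℝ E] [FiniteDimensional ℝ E]
  [MeasurableSpace E] [BorelSpace E]

/-- Gaussian integral of a cone in polar coordinates. -/
lemma integral_indicator_cone_exp_neg_sq_norm (μ : Measure E) [μ.IsAddHaarMeasure] [Nontrivial E]
    {c : Set E} (hc : MeasurableSet c) (hcone : ∀ r : ℝ, 0 < r → ∀ x, r • x ∈ c ↔ x ∈ c) :
    ∫ x, c.indicator (fun x => Real.exp (-‖x‖ ^ 2)) x ∂μ =
      μ.toSphere.real {u | (u : E) ∈ c} *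
        ∫ r : Set.Ioi (0 : ℝ), Real.exp (-(r : ℝ) ^ 2)
          ∂(Measure.volumeIoiPow (Module.finrank ℝ E - 1)) := by
  have hS : MeasurableSet {u : Metric.sphere (0 : E) 1 | (u : E) ∈ c} :=
    measurable_subtype_coe hc
  calc ∫ x, c.indicator (fun x => Real.exp (-‖x‖ ^ 2)) x ∂μ
      = ∫ x : ({(0)}ᶜ : Set E), c.indicator (fun x => Real.exp (-‖x‖ ^ 2)) x.1
          ∂(μ.comap (↑)) := by
        rw [integral_subtype_comap (measurableSet_singleton _).compl
          (fun x => c.indicator (fun x => Real.exp (-‖x‖ ^ 2)) x),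
          restrict_compl_singleton]
    _ = ∫ p, {u : Metric.sphere (0 : E) 1 | (u : E) ∈ c}.indicator 1 p.1 *
          Real.exp (-(p.2 : ℝ) ^ 2)
          ∂μ.toSphere.prod (.volumeIoiPow (Module.finrank ℝ E - 1)) := by
        rw [← μ.measurePreserving_homeomorphUnitSphereProd.integral_comp
          (Homeomorph.measurableEmbedding _)]
        congr 1
        ext x
        have hx : 0 < ‖(x : E)‖ := norm_pos_iff.2 x.2
        -- Membership in the cone depends only on the direction x/‖x‖, so the integrand splits into
        -- an angular and a radial factor.
        have h := hcone ‖(x : E)‖⁻¹ (inv_pos.2 hx) x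
        by_cases hxc : (x : E) ∈ c
        · simp [hxc, h]
        · simp [hxc, h]
    _ = _ := by
        rw [integral_prod_mul
          ({u : Metric.sphere (0 : E) 1 | (u : E) ∈ c}.indicator (1 : Metric.sphere (0 : E) 1 → ℝ))
          (fun r : Set.Ioi (0 : ℝ) => Real.exp (-(r : ℝ) ^ 2)), integral_indicator_one hS]

end Polar

/-! ### Solid angles as Gaussian ratios -/

section Fraction

/-- The polar formula for c and for the whole span has the same radial factor, which cancels in the
quotient. -/
lemma sphereFraction_eq_gaussian {n : ℕ} {c : Set (EuclideanSpace ℝ (Fin n))}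
    (hc : MeasurableSet c) (hcone : ∀ r : ℝ, 0 < r → ∀ x, r • x ∈ c ↔ x ∈ c)
    (hne : ∃ x ∈ c, x ≠ 0) :
    sphereFraction c =
      (∫ x : Submodule.span ℝ c,
        {x : Submodule.span ℝ c | (x : EuclideanSpace ℝ (Fin n)) ∈ c}.indicator
          (fun x => Real.exp (-‖x‖ ^ 2)) x) /
      ∫ x : Submodule.span ℝ c, Real.exp (-‖x‖ ^ 2) := by
  obtain ⟨x, hx, hx0⟩ := hne
  have : Nontrivial (Submodule.span ℝ c) :=
    ⟨⟨⟨x, Submodule.subset_span hx⟩, 0, fun h => hx0 (congrArg Subtype.val h)⟩⟩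
  have h1 := integral_indicator_cone_exp_neg_sq_norm
    (volume : Measure (Submodule.span ℝ c))
    (c := {x : Submodule.span ℝ c | (x : EuclideanSpace ℝ (Fin n)) ∈ c})
    (measurable_subtype_coe hc) (fun r hr x => hcone r hr x)
  have h2 := integral_indicator_cone_exp_neg_sq_norm
    (volume : Measure (Submodule.span ℝ c)) MeasurableSet.univ (fun r hr x => by simp)
  have h3 : 0 < ∫ x : Submodule.span ℝ c, Real.exp (-‖x‖ ^ 2) := by
    have h := GaussianFourier.integral_rexp_neg_mul_sq_norm (V := Submodule.span ℝ c) one_pos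
    simp only [neg_mul, one_mul, div_one] at h
    rw [h]
    positivity
  simp only [Set.indicator_univ, Set.mem_univ, Set.ofPred_true] at h2
  rw [h1, h2, sphereFraction, subspaceSphereMeasure]
  -- The radial factor is nonzero since the total Gaussian mass is positive.
  refine (mul_div_mul_right _ _ fun h0 => ?_).symm
  rw [h0, mul_zero] at h2
  exact h3.ne' h2

lemma LinearIsometry.integral_eq_integral_range {E F : Type*} [NormedAddCommGroup E]
    [InnerProductSpace ℝ E] [FiniteDimensional ℝ E] [MeasurableSpace E] [BorelSpace E]
    [NormedAddCommGroup F] [InnerProductSpace ℝ F] [MeasurableSpace F]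
    [BorelSpace F] [FiniteDimensional ℝ F] (T : E →ₗᵢ[ℝ] F) {V : Submodule ℝ F}
    (hV : LinearMap.range T.toLinearMap = V) (f : F → ℝ) :
    ∫ x : V, f x = ∫ z, f (T z) := by
  subst hV
  rw [← T.equivRange.measurePreserving.integral_comp
    T.equivRange.toHomeomorph.measurableEmbedding]
  rfl

/-- An isometry onto the span preserves both volume and the Gaussian, so the ratio may be computed
in the model space E. -/
lemma sphereFraction_eq_of_linearIsometry {n : ℕ} {E : Type*} [NormedAddCommGroup E]
    [InnerProductSpace ℝ E] [FiniteDimensional ℝ E] [MeasurableSpace E] [BorelSpace E]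
    {c : Set (EuclideanSpace ℝ (Fin n))} (T : E →ₗᵢ[ℝ] EuclideanSpace ℝ (Fin n))
    (hc : MeasurableSet c) (hcone : ∀ r : ℝ, 0 < r → ∀ x, r • x ∈ c ↔ x ∈ c)
    (hne : ∃ x ∈ c, x ≠ 0) (hT : LinearMap.range T.toLinearMap = Submodule.span ℝ c) :
    sphereFraction c =
      (∫ z, (T ⁻¹' c).indicator (fun z => Real.exp (-‖z‖ ^ 2)) z) /
        ∫ z : E, Real.exp (-‖z‖ ^ 2) := by
  rw [sphereFraction_eq_gaussian hc hcone hne]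
  have h1 := T.integral_eq_integral_range hT (c.indicator (fun x => Real.exp (-‖x‖ ^ 2)))
  have h2 := T.integral_eq_integral_range hT (fun x => Real.exp (-‖x‖ ^ 2))
  simp only [T.norm_map] at h2
  rw [← h2]
  congr 1
  refine Eq.trans (Eq.trans ?_ h1) ?_
  · refine integral_congr_ae (Eventually.of_forall fun x => ?_)
    by_cases hx : (x : EuclideanSpace ℝ (Fin n)) ∈ c <;> simp [hx]
  · refine integral_congr_ae (Eventually.of_forall fun z => ?_)
    by_cases hz : T z ∈ c <;> simp [hz]

end Fraction

/-! ### Gaussian mass of the model wedge -/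

section Wedge

lemma integral_indicator_abs_le_exp_neg_sq {a : ℝ} (ha : 0 ≤ a) :
    ∫ y : ℝ, {y : ℝ | |y| ≤ a}.indicator (fun y => Real.exp (-y ^ 2)) y = √Real.pi * erfG a := by
  have hp : 0 < √Real.pi := Real.sqrt_pos.2 Real.pi_pos
  have hset : {y : ℝ | |y| ≤ a} = Set.Icc (-a) a := by ext y; simp [abs_le]
  have hi : ∀ u v : ℝ, IntervalIntegrable (fun y : ℝ => Real.exp (-y ^ 2)) volume u v :=
    fun u v => continuous_exp_neg_sq.intervalIntegrable u v
  have hneg : ∫ y in (-a)..0, Real.exp (-y ^ 2) = ∫ y in (0 : ℝ)..a, Real.exp (-y ^ 2) := by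
    have := intervalIntegral.integral_comp_neg (a := 0) (b := a) (fun y : ℝ => Real.exp (-y ^ 2))
    simpa using this.symm
  rw [hset, integral_indicator measurableSet_Icc, integral_Icc_eq_integral_Ioc,
    ← intervalIntegral.integral_of_le (by linarith),
    ← intervalIntegral.integral_add_adjacent_intervals (hi (-a) 0) (hi 0 a), hneg, erfG]
  field_simp
  ring

lemma exp_neg_sq_norm_eq_prod {ι : Type*} [Fintype ι] (y : EuclideanSpace ℝ ι) :
    Real.exp (-‖y‖ ^ 2) = ∏ k, Real.exp (-(y k) ^ 2) := by
  rw [EuclideanSpace.norm_sq_eq, ← Real.exp_sum]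
  simp

lemma integral_indicator_box_exp_neg_sq_norm {ι : Type*} [Fintype ι] {b : ι → ℝ}
    (hb : ∀ k, 0 ≤ b k) :
    ∫ y : EuclideanSpace ℝ ι, {y : EuclideanSpace ℝ ι | ∀ k, |y k| ≤ b k}.indicator
      (fun y => Real.exp (-‖y‖ ^ 2)) y = √Real.pi ^ Fintype.card ι * ∏ k, erfG (b k) := by
  have h : ∀ y : EuclideanSpace ℝ ι, {y : EuclideanSpace ℝ ι | ∀ k, |y k| ≤ b k}.indicator
      (fun y => Real.exp (-‖y‖ ^ 2)) y =
      ∏ k, {t : ℝ | |t| ≤ b k}.indicator (fun t => Real.exp (-t ^ 2)) (y.ofLp k) := by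
    intro y
    by_cases hy : ∀ k, |y k| ≤ b k
    · rw [Set.indicator_of_mem (by exact hy), exp_neg_sq_norm_eq_prod]
      exact Finset.prod_congr rfl fun k _ => by
        rw [Set.indicator_of_mem (show y.ofLp k ∈ {t : ℝ | |t| ≤ b k} from hy k)]
    · rw [Set.indicator_of_notMem (by exact hy)]
      push Not at hy
      obtain ⟨k, hk⟩ := hy
      rw [Finset.prod_eq_zero (Finset.mem_univ k)]
      exact Set.indicator_of_notMem
        (show y.ofLp k ∉ {t : ℝ | |t| ≤ b k} from not_le.2 hk) _
  simp_rw [h]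
  rw [(PiLp.volume_preserving_ofLp ι).integral_comp
    (MeasurableEquiv.toLp 2 (ι → ℝ)).symm.measurableEmbedding
    (fun y : ι → ℝ => ∏ k, {t : ℝ | |t| ≤ b k}.indicator (fun t => Real.exp (-t ^ 2)) (y k)),
    integral_fintype_prod_volume_eq_prod
      (fun k => {t : ℝ | |t| ≤ b k}.indicator (fun t => Real.exp (-t ^ 2)))]
  simp_rw [fun k => integral_indicator_abs_le_exp_neg_sq (hb k)]
  rw [Finset.prod_mul_distrib, Finset.prod_const, Finset.card_univ]

lemma integral_exp_neg_sq_norm_euclideanSpace (ι : Type*) [Fintype ι] :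
    ∫ y : EuclideanSpace ℝ ι, Real.exp (-‖y‖ ^ 2) = √Real.pi ^ Fintype.card ι := by
  simp_rw [exp_neg_sq_norm_eq_prod]
  rw [(PiLp.volume_preserving_ofLp ι).integral_comp
    (MeasurableEquiv.toLp 2 (ι → ℝ)).symm.measurableEmbedding
    (fun y : ι → ℝ => ∏ k, Real.exp (-(y k) ^ 2)),
    integral_fintype_prod_volume_eq_pow (fun t : ℝ => Real.exp (-t ^ 2))]
  have := integral_gaussian 1
  simp only [neg_mul, one_mul, div_one] at this
  rw [this]

variable {ι : Type*} [Fintype ι]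

lemma integrable_exp_neg_sq_norm {V : Type*} [NormedAddCommGroup V] [InnerProductSpace ℝ V]
    [FiniteDimensional ℝ V] [MeasurableSpace V] [BorelSpace V] :
    Integrable fun v : V => Real.exp (-‖v‖ ^ 2) := by
  refine Integrable.of_integral_ne_zero ?_
  have h := GaussianFourier.integral_rexp_neg_mul_sq_norm (V := V) one_pos
  simp only [neg_mul, one_mul, div_one] at h
  rw [h]
  positivity

/-- The wedge `{(a, y) : 0 ≤ a, |yₖ| ≤ vₖ a}`. -/
def erfWedge (v : ι → ℝ) : Set (WithLp 2 (ℝ × EuclideanSpace ℝ ι)) :=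
  {z | 0 ≤ z.fst ∧ ∀ k, |z.snd k| ≤ v k * z.fst}

lemma exp_neg_sq_norm_prod (z : WithLp 2 (ℝ × EuclideanSpace ℝ ι)) :
    Real.exp (-‖z‖ ^ 2) = Real.exp (-z.fst ^ 2) * Real.exp (-‖z.snd‖ ^ 2) := by
  rw [WithLp.prod_norm_sq_eq_of_L2, ← Real.exp_add, Real.norm_eq_abs, sq_abs]
  ring_nf

lemma measurableSet_erfWedge (v : ι → ℝ) : MeasurableSet (erfWedge v) := by
  have h1 : Continuous fun z : WithLp 2 (ℝ × EuclideanSpace ℝ ι) => z.fst := by fun_prop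
  have h2 : ∀ k, Continuous fun z : WithLp 2 (ℝ × EuclideanSpace ℝ ι) => z.snd k := by
    intro k; fun_prop
  have h3 : erfWedge v = {z | 0 ≤ z.fst} ∩ ⋂ k, {z | |z.snd k| ≤ v k * z.fst} := by
    ext z; simp [erfWedge]
  rw [h3]
  exact ((isClosed_le continuous_const h1).inter
    (isClosed_iInter fun k => isClosed_le (h2 k).abs (continuous_const.mul h1))).measurableSet

lemma integral_exp_neg_sq_norm_prod :
    ∫ z : WithLp 2 (ℝ × EuclideanSpace ℝ ι), Real.exp (-‖z‖ ^ 2) =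
      √Real.pi * √Real.pi ^ Fintype.card ι := by
  simp_rw [exp_neg_sq_norm_prod]
  have h := (WithLp.volume_preserving_ofLp ℝ (EuclideanSpace ℝ ι)).integral_comp
    (MeasurableEquiv.toLp 2 (ℝ × EuclideanSpace ℝ ι)).symm.measurableEmbedding
    (fun p : ℝ × EuclideanSpace ℝ ι => Real.exp (-p.1 ^ 2) * Real.exp (-‖p.2‖ ^ 2))
  refine h.trans ?_
  rw [Measure.volume_eq_prod, integral_prod_mul (fun a : ℝ => Real.exp (-a ^ 2))
      (fun y : EuclideanSpace ℝ ι => Real.exp (-‖y‖ ^ 2)), integral_exp_neg_sq_norm_euclideanSpace]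
  have := integral_gaussian 1
  simp only [neg_mul, one_mul, div_one] at this
  rw [this]

/-- By Fubini: the slice of the wedge at height a ≥ 0 is the box |y_k| ≤ v_k a, whose Gaussian mass
is a product of error functions. -/
lemma integral_indicator_erfWedge {v : ι → ℝ} (hv : ∀ k, 0 ≤ v k) :
    ∫ z, (erfWedge v).indicator (fun z => Real.exp (-‖z‖ ^ 2)) z =
      √Real.pi ^ Fintype.card ι *
        ∫ a in Set.Ioi (0 : ℝ), Real.exp (-a ^ 2) * ∏ k, erfG (v k * a) := by
  set f : ℝ × EuclideanSpace ℝ ι → ℝ := fun p => (erfWedge v).indicator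
    (fun z => Real.exp (-‖z‖ ^ 2)) (WithLp.toLp 2 p) with hf
  have hmp := WithLp.volume_preserving_toLp ℝ (EuclideanSpace ℝ ι)
  have hme := (MeasurableEquiv.toLp 2 (ℝ × EuclideanSpace ℝ ι)).measurableEmbedding
  have hint : Integrable f :=
    (hmp.integrable_comp_emb hme).2 (integrable_exp_neg_sq_norm.indicator (measurableSet_erfWedge v))
  have h1 : ∫ z, (erfWedge v).indicator (fun z => Real.exp (-‖z‖ ^ 2)) z = ∫ p, f p :=
    (hmp.integral_comp hme _).symm
  rw [h1, Measure.volume_eq_prod, integral_prod _ hint, ← integral_Ici_eq_integral_Ioi,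
    ← integral_const_mul, ← integral_indicator measurableSet_Ici]
  congr 1
  ext a
  by_cases ha : 0 ≤ a
  · rw [Set.indicator_of_mem (by exact ha)]
    have h2 : ∀ y, f (a, y) = Real.exp (-a ^ 2) *
        {y : EuclideanSpace ℝ ι | ∀ k, |y k| ≤ v k * a}.indicator
          (fun y => Real.exp (-‖y‖ ^ 2)) y := by
      intro y
      simp only [hf]
      by_cases hy : ∀ k, |y k| ≤ v k * a
      · rw [Set.indicator_of_mem (by exact ⟨ha, hy⟩), Set.indicator_of_mem (by exact hy),
          exp_neg_sq_norm_prod]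
        rfl
      · rw [Set.indicator_of_notMem (fun h => hy h.2), Set.indicator_of_notMem (by exact hy),
          mul_zero]
    simp_rw [h2]
    rw [integral_const_mul, integral_indicator_box_exp_neg_sq_norm
      fun k => mul_nonneg (hv k) ha]
    ring
  · rw [Set.indicator_of_notMem (by exact ha)]
    have h2 : ∀ y, f (a, y) = 0 := fun y => Set.indicator_of_notMem (fun h => ha h.1) _
    simp [h2]

end Wedge

/-! ### Normal cones of the faces of the skewed cross-polytope -/

section Polytope

variable {n : ℕ} {w : Fin n → ℝ} {L : Finset (Fin n)} {σ : Fin n → ℤˣ}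

lemma intUnit_mul_self_cast (s : ℤˣ) : ((s : ℤ) : ℝ) * ((s : ℤ) : ℝ) = 1 := by
  rcases Int.units_eq_one_or s with rfl | rfl <;> simp

lemma abs_intUnit_cast (s : ℤˣ) : |((s : ℤ) : ℝ)| = 1 := by
  rcases Int.units_eq_one_or s with rfl | rfl <;> simp

lemma convex_skewedCrossPolytope (hw : ∀ k, 0 < w k) : Convex ℝ (skewedCrossPolytope w) := by
  intro x hx y hy a b ha hb hab
  simp only [skewedCrossPolytope, Set.mem_ofPred_eq] at hx hy ⊢
  calc ∑ i, w i * |(a • x + b • y) i| ≤ ∑ i, (a * (w i * |x i|) + b * (w i * |y i|)) := by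
        refine Finset.sum_le_sum fun i _ => ?_
        have h : |(a • x + b • y) i| ≤ a * |x i| + b * |y i| := by
          have := abs_add_le (a * x i) (b * y i)
          rw [abs_mul, abs_mul, abs_of_nonneg ha, abs_of_nonneg hb] at this
          simpa using this
        have := mul_le_mul_of_nonneg_left h (hw i).le
        linarith
    _ = a * ∑ i, w i * |x i| + b * ∑ i, w i * |y i| := by
        rw [Finset.sum_add_distrib, Finset.mul_sum, Finset.mul_sum]
    _ ≤ a * 1 + b * 1 := by gcongr
    _ = 1 := by linarith

lemma single_mem_skewedCrossPolytope (hw : ∀ k, 0 < w k) (k : Fin n) (s : ℤˣ) :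
    EuclideanSpace.single k (((s : ℤ) : ℝ) / w k) ∈ skewedCrossPolytope w := by
  simp only [skewedCrossPolytope, Set.mem_ofPred_eq]
  rw [Finset.sum_eq_single k]
  · rw [PiLp.single_apply, if_pos rfl, abs_div, abs_intUnit_cast, abs_of_pos (hw k)]
    exact (mul_one_div_cancel (hw k).ne').le
  · intro b _ hb
    simp [hb]
  · simp

lemma skewedFace_subset (hw : ∀ k, 0 < w k) : skewedFace w L σ ⊆ skewedCrossPolytope w := by
  refine convexHull_min ?_ (convex_skewedCrossPolytope hw)
  rintro _ ⟨k, -, rfl⟩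
  exact single_mem_skewedCrossPolytope hw k (σ k)

lemma inner_single_div (u : EuclideanSpace ℝ (Fin n)) (k : Fin n) (a : ℝ) :
    inner ℝ u (EuclideanSpace.single k a) = u k * a := by
  simp [EuclideanSpace.inner_single_right, mul_comm]

lemma inner_eq_of_mem_skewedFace {u x : EuclideanSpace ℝ (Fin n)} {s : ℝ} (hw : ∀ k, 0 < w k)
    (hu : ∀ k ∈ L, u k = ((σ k : ℤ) : ℝ) * (w k * s)) (hx : x ∈ skewedFace w L σ) :
    inner ℝ u x = s := by
  have hconv : Convex ℝ {x : EuclideanSpace ℝ (Fin n) | inner ℝ u x = s} :=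
    convex_hyperplane (f := fun x => inner ℝ u x)
      ⟨fun x y => inner_add_right u x y, fun a x => real_inner_smul_right u x a⟩ s
  refine convexHull_min ?_ hconv hx
  rintro _ ⟨k, hk, rfl⟩
  have := (hw k).ne'
  simp only [Set.mem_ofPred_eq, inner_single_div]
  rw [hu k hk]
  have h := intUnit_mul_self_cast (σ k)
  field_simp
  linear_combination s * h

lemma skewedFace_ne (hw : ∀ k, 0 < w k) : skewedFace w L σ ≠ skewedCrossPolytope w := by
  intro h
  have h0 : (0 : EuclideanSpace ℝ (Fin n)) ∈ skewedFace w L σ := by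
    rw [h]; simp [skewedCrossPolytope]
  -- The functional with coefficients σ_k w_k equals 1 on the face, so the origin cannot lie there.
  have := inner_eq_of_mem_skewedFace (s := 1)
    (u := WithLp.toLp 2 fun k => ((σ k : ℤ) : ℝ) * (w k * 1)) hw (fun k _ => rfl) h0
  simp at this

/-- The parameter s is the maximum of ⟨u, ·⟩ over the polytope. Comparing a vertex of F with all
vertices ±e_i/w_i bounds every |u_i|, and the maximum being attained at each vertex of F forces
equality with the right sign on L. The converse is the duality between the weighted ℓ¹ and ℓ^∞
norms. -/
lemma mem_outwardNormalCone_iff {u : EuclideanSpace ℝ (Fin n)} (hw : ∀ k, 0 < w k)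
    (hL : L.Nonempty) :
    u ∈ outwardNormalCone (skewedFace w L σ) (skewedCrossPolytope w) ↔
      ∃ s, 0 ≤ s ∧ (∀ k ∈ L, u k = ((σ k : ℤ) : ℝ) * (w k * s)) ∧ ∀ k, |u k| ≤ w k * s := by
  constructor
  · intro hu
    have hv : ∀ k ∈ L, EuclideanSpace.single k (((σ k : ℤ) : ℝ) / w k) ∈ skewedFace w L σ :=
      fun k hk => subset_convexHull ℝ _ ⟨k, hk, rfl⟩
    have key : ∀ k ∈ L, ∀ i, |u i| ≤ w i * (u k * (((σ k : ℤ) : ℝ) / w k)) := by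
      intro k hk i
      have h1 := hu _ (hv k hk) _ (single_mem_skewedCrossPolytope hw i 1)
      have h2 := hu _ (hv k hk) _ (single_mem_skewedCrossPolytope hw i (-1))
      rw [inner_single_div, inner_single_div] at h1 h2
      have hi := hw i
      have e1 := mul_le_mul_of_nonneg_left h1 hi.le
      have e2 := mul_le_mul_of_nonneg_left h2 hi.le
      have f1 : w i * (u i * ((((1 : ℤˣ) : ℤ) : ℝ) / w i)) = u i := by
        field_simp; simp
      have f2 : w i * (u i * ((((-1 : ℤˣ) : ℤ) : ℝ) / w i)) = -u i := by
        field_simp; simp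
      rw [f1] at e1
      rw [f2] at e2
      exact abs_le.2 ⟨by linarith, e1⟩
    obtain ⟨k₀, hk₀⟩ := hL
    set s := u k₀ * (((σ k₀ : ℤ) : ℝ) / w k₀) with hs
    have hs0 : 0 ≤ s := by
      have := (abs_nonneg _).trans (key k₀ hk₀ k₀)
      exact nonneg_of_mul_nonneg_right this (hw k₀)
    refine ⟨s, hs0, fun k hk => ?_, key k₀ hk₀⟩
    have h1 := hu _ (hv k hk) _ (skewedFace_subset hw (hv k₀ hk₀))
    rw [inner_single_div, inner_single_div, ← hs] at h1
    have h2 := key k₀ hk₀ k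
    have hk' := hw k
    have h3 := mul_le_mul_of_nonneg_left h1 hk'.le
    have h4 : w k * (u k * (((σ k : ℤ) : ℝ) / w k)) = u k * ((σ k : ℤ) : ℝ) := by field_simp
    rw [h4] at h3
    have h5 : u k * ((σ k : ℤ) : ℝ) ≤ |u k| := by
      have := le_abs_self (u k * ((σ k : ℤ) : ℝ))
      rwa [abs_mul, abs_intUnit_cast, mul_one] at this
    have h6 : u k * ((σ k : ℤ) : ℝ) = w k * s := by linarith
    rw [← h6]
    linear_combination -u k * intUnit_mul_self_cast (σ k)
  · rintro ⟨s, hs, h1, h2⟩ x hx y hy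
    rw [inner_eq_of_mem_skewedFace hw h1 hx]
    calc inner ℝ u y = ∑ k, u k * y k := by
          simp [PiLp.inner_apply, mul_comm]
      _ ≤ ∑ k, s * (w k * |y k|) := by
          refine Finset.sum_le_sum fun k _ => ?_
          have := le_abs_self (u k * y k)
          rw [abs_mul] at this
          have := mul_le_mul_of_nonneg_right (h2 k) (abs_nonneg (y k))
          linarith
      _ = s * ∑ k, w k * |y k| := by rw [Finset.mul_sum]
      _ ≤ s * 1 := mul_le_mul_of_nonneg_left hy hs
      _ = s := mul_one s

lemma isClosed_outwardNormalCone (F P : Set (EuclideanSpace ℝ (Fin n))) :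
    IsClosed (outwardNormalCone F P) := by
  have h : outwardNormalCone F P =
      ⋂ x ∈ F, ⋂ y ∈ P, {u | inner ℝ u y ≤ inner ℝ u x} := by
    ext u; simp [outwardNormalCone]
  rw [h]
  exact isClosed_biInter fun x _ => isClosed_biInter fun y _ =>
    isClosed_le (by fun_prop) (by fun_prop)

lemma smul_mem_outwardNormalCone_iff (F P : Set (EuclideanSpace ℝ (Fin n))) {r : ℝ} (hr : 0 < r)
    (u : EuclideanSpace ℝ (Fin n)) : r • u ∈ outwardNormalCone F P ↔ u ∈ outwardNormalCone F P := by
  simp only [outwardNormalCone, Set.mem_ofPred_eq, real_inner_smul_left, mul_le_mul_iff_right₀ hr]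

variable (w L σ)

/-- The linear map onto the span of the normal cone of a face: the first coordinate spans the
direction of the face normal, the second one collects the coordinates off the support. -/
noncomputable def normalSpanMap :
    WithLp 2 (ℝ × EuclideanSpace ℝ {k // k ∉ L}) →ₗ[ℝ] EuclideanSpace ℝ (Fin n) where
  toFun z := WithLp.toLp 2 fun k => if h : k ∈ L then
    ((σ k : ℤ) : ℝ) * (w k * (z.fst / √(∑ i ∈ L, w i ^ 2))) else z.snd ⟨k, h⟩
  map_add' x y := by
    ext k
    by_cases h : k ∈ L <;> simp [h]
    ring
  map_smul' r x := by
    ext k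
    by_cases h : k ∈ L <;> simp [h]
    ring

variable {w L σ}

lemma normalSpanMap_apply_of_mem (z : WithLp 2 (ℝ × EuclideanSpace ℝ {k // k ∉ L})) {k : Fin n}
    (h : k ∈ L) : normalSpanMap w L σ z k =
      ((σ k : ℤ) : ℝ) * (w k * (z.fst / √(∑ i ∈ L, w i ^ 2))) := by
  simp [normalSpanMap, h]

lemma normalSpanMap_apply_of_notMem (z : WithLp 2 (ℝ × EuclideanSpace ℝ {k // k ∉ L}))
    {k : Fin n} (h : k ∉ L) : normalSpanMap w L σ z k = z.snd ⟨k, h⟩ := by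
  simp [normalSpanMap, h]

lemma sum_sq_weights_pos (hw : ∀ k, 0 < w k) (hL : L.Nonempty) : 0 < ∑ i ∈ L, w i ^ 2 :=
  Finset.sum_pos (fun i _ => pow_pos (hw i) 2) hL

/-- The vector (σ_k w_k) supported on L has length √(∑ w_i²), which is the divisor in the first
coordinate. -/
lemma norm_normalSpanMap (hw : ∀ k, 0 < w k) (hL : L.Nonempty)
    (z : WithLp 2 (ℝ × EuclideanSpace ℝ {k // k ∉ L})) : ‖normalSpanMap w L σ z‖ = ‖z‖ := by
  have hA := sum_sq_weights_pos hw hL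
  refine (sq_eq_sq₀ (norm_nonneg _) (norm_nonneg _)).1 ?_
  rw [EuclideanSpace.norm_sq_eq, WithLp.prod_norm_sq_eq_of_L2, EuclideanSpace.norm_sq_eq]
  simp only [Real.norm_eq_abs, sq_abs]
  rw [← Finset.sum_add_sum_compl L]
  congr 1
  · have h : ∀ k ∈ L, (normalSpanMap w L σ z k) ^ 2 =
        w k ^ 2 * (z.fst ^ 2 / ∑ i ∈ L, w i ^ 2) := by
      intro k hk
      rw [normalSpanMap_apply_of_mem z hk, mul_pow, mul_pow, div_pow, Real.sq_sqrt hA.le, pow_two,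
        intUnit_mul_self_cast, one_mul]
    rw [Finset.sum_congr rfl h, ← Finset.sum_mul]
    field_simp
  · rw [Finset.sum_subtype (F := inferInstance) Lᶜ (p := fun k => k ∉ L) (by simp)]
    refine Finset.sum_congr rfl fun k _ => ?_
    rw [normalSpanMap_apply_of_notMem z k.2]

/-- `normalSpanMap` as a linear isometry. -/
noncomputable def normalSpanIsometry (hw : ∀ k, 0 < w k) (hL : L.Nonempty) :
    WithLp 2 (ℝ × EuclideanSpace ℝ {k // k ∉ L}) →ₗᵢ[ℝ] EuclideanSpace ℝ (Fin n) where
  toLinearMap := normalSpanMap w L σ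
  norm_map' := norm_normalSpanMap hw hL

/-- The scale s of the normal vector corresponds to the first coordinate divided by √(∑ w_i²).
Nonemptiness of L allows s to be recovered from any coordinate in L. -/
lemma normalSpanMap_mem_cone_iff (hw : ∀ k, 0 < w k) (hL : L.Nonempty)
    (z : WithLp 2 (ℝ × EuclideanSpace ℝ {k // k ∉ L})) :
    normalSpanMap w L σ z ∈ outwardNormalCone (skewedFace w L σ) (skewedCrossPolytope w) ↔
      z ∈ erfWedge fun k : {k // k ∉ L} => w k / √(∑ i ∈ L, w i ^ 2) := by
  have hA := Real.sqrt_pos.2 (sum_sq_weights_pos hw hL)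
  rw [mem_outwardNormalCone_iff hw hL]
  have hmul : ∀ k : {k // k ∉ L}, w k / √(∑ i ∈ L, w i ^ 2) * z.fst =
      w k * (z.fst / √(∑ i ∈ L, w i ^ 2)) := fun k => by ring
  constructor
  · rintro ⟨s, hs, h1, h2⟩
    obtain ⟨k, hk⟩ := hL
    have h3 := h1 k hk
    rw [normalSpanMap_apply_of_mem z hk] at h3
    have h4 : z.fst / √(∑ i ∈ L, w i ^ 2) = s := by
      have h5 : ((σ k : ℤ) : ℝ) ≠ 0 := by
        intro h0
        have := intUnit_mul_self_cast (σ k)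
        rw [h0] at this
        simp at this
      exact mul_left_cancel₀ (hw k).ne' (mul_left_cancel₀ h5 h3)
    refine ⟨?_, fun k => ?_⟩
    · rw [← h4] at hs
      simpa [hA.ne'] using mul_nonneg hs hA.le
    · rw [hmul, h4, ← normalSpanMap_apply_of_notMem (w := w) (σ := σ) z k.2]
      exact h2 k
  · rintro ⟨h0, h1⟩
    refine ⟨z.fst / √(∑ i ∈ L, w i ^ 2), by positivity,
      fun k hk => normalSpanMap_apply_of_mem z hk, fun k => ?_⟩
    by_cases hk : k ∈ L
    · rw [normalSpanMap_apply_of_mem z hk, abs_mul, abs_intUnit_cast, one_mul, abs_of_nonneg]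
      have := hw k
      positivity
    · rw [normalSpanMap_apply_of_notMem z hk, ← hmul ⟨k, hk⟩]
      exact h1 ⟨k, hk⟩

lemma range_normalSpanMap (hw : ∀ k, 0 < w k) (hL : L.Nonempty) :
    LinearMap.range (normalSpanMap w L σ) =
      Submodule.span ℝ (outwardNormalCone (skewedFace w L σ) (skewedCrossPolytope w)) := by
  have hA := Real.sqrt_pos.2 (sum_sq_weights_pos hw hL)
  refine le_antisymm ?_ (Submodule.span_le.2 fun u hu => ?_)
  · rintro _ ⟨z, rfl⟩
    set v : {k // k ∉ L} → ℝ := fun k => w k / √(∑ i ∈ L, w i ^ 2) with hv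
    have hvpos : ∀ k, 0 < v k := fun k => div_pos (hw k) hA
    have hR : ∀ k, |z.snd k| ≤ v k * ∑ i, |z.snd i| / v i := by
      intro k
      have := Finset.single_le_sum (f := fun i => |z.snd i| / v i)
        (fun i _ => div_nonneg (abs_nonneg _) (hvpos i).le) (Finset.mem_univ k)
      rw [div_le_iff₀ (hvpos k)] at this
      linarith
    set R := ∑ i, |z.snd i| / v i with hRdef
    have hR0 : 0 ≤ R := Finset.sum_nonneg fun i _ => div_nonneg (abs_nonneg _) (hvpos i).le
    -- A point on the wedge axis, far enough out that z + z₂ also lies in the wedge; z is then a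
    -- difference of two wedge points, so the cone spans the whole range.
    set z₂ : WithLp 2 (ℝ × EuclideanSpace ℝ {k // k ∉ L}) :=
      WithLp.toLp 2 (|z.fst| + R, 0) with hz₂
    have hz₂mem : z₂ ∈ erfWedge v := by
      refine ⟨?_, fun k => ?_⟩
      · show 0 ≤ |z.fst| + R
        positivity
      · show |(0 : ℝ)| ≤ v k * (|z.fst| + R)
        rw [abs_zero]
        exact mul_nonneg (hvpos k).le (by positivity)
    have hz₁mem : z + z₂ ∈ erfWedge v := by
      have h := neg_abs_le z.fst
      refine ⟨?_, fun k => ?_⟩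
      · show 0 ≤ z.fst + (|z.fst| + R)
        linarith
      · show |z.snd k + 0| ≤ v k * (z.fst + (|z.fst| + R))
        rw [add_zero]
        exact (hR k).trans (mul_le_mul_of_nonneg_left (by linarith) (hvpos k).le)
    have : normalSpanMap w L σ z = normalSpanMap w L σ (z + z₂) - normalSpanMap w L σ z₂ := by
      rw [map_add, add_sub_cancel_right]
    rw [this]
    exact Submodule.sub_mem _
      (Submodule.subset_span ((normalSpanMap_mem_cone_iff hw hL _).2 hz₁mem))
      (Submodule.subset_span ((normalSpanMap_mem_cone_iff hw hL _).2 hz₂mem))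
  · obtain ⟨s, hs, h1, h2⟩ := (mem_outwardNormalCone_iff hw hL).1 hu
    refine ⟨WithLp.toLp 2 (√(∑ i ∈ L, w i ^ 2) * s, WithLp.toLp 2 fun k => u k), ?_⟩
    ext k
    by_cases hk : k ∈ L
    · rw [normalSpanMap_apply_of_mem _ hk, h1 k hk]
      congr 2
      exact mul_div_cancel_left₀ s hA.ne'
    · rw [normalSpanMap_apply_of_notMem _ hk]
      rfl

/-- The external angle of a face of the skewed cross-polytope as a one-dimensional integral. -/
theorem externalAngle_skewedFace (hw : ∀ k, 0 < w k) (hL : L.Nonempty) :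
    externalAngle (skewedFace w L σ) (skewedCrossPolytope w) =
      √((∑ i ∈ L, w i ^ 2) / Real.pi) * ∫ s in Set.Ioi (0 : ℝ),
        Real.exp (-(∑ i ∈ L, w i ^ 2) * s ^ 2) * ∏ k ∈ Lᶜ, erfG (w k * s) := by
  have hA := sum_sq_weights_pos hw hL
  set A := ∑ i ∈ L, w i ^ 2 with hAdef
  have hA' := Real.sqrt_pos.2 hA
  have hp : 0 < √Real.pi := Real.sqrt_pos.2 Real.pi_pos
  rw [externalAngle, if_neg (skewedFace_ne hw), if_pos (skewedFace_subset hw),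
    sphereFraction_eq_of_linearIsometry (normalSpanIsometry (σ := σ) hw hL)
      (isClosed_outwardNormalCone _ _).measurableSet
      (fun r hr x => smul_mem_outwardNormalCone_iff _ _ hr x) ?_ (range_normalSpanMap hw hL),
    integral_exp_neg_sq_norm_prod]
  · have hpre : (normalSpanIsometry (σ := σ) hw hL) ⁻¹'
        (outwardNormalCone (skewedFace w L σ) (skewedCrossPolytope w)) =
        erfWedge fun k : {k // k ∉ L} => w k / √A :=
      Set.ext fun z => normalSpanMap_mem_cone_iff hw hL z
    rw [hpre, integral_indicator_erfWedge fun k : {k // k ∉ L} => (div_pos (hw k) hA').le]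
    -- The substitution a = √A s replaces arc length along the unit face normal by the scale s and
    -- produces the prefactor √A.
    have hsub := integral_comp_mul_left_Ioi
      (fun a => Real.exp (-a ^ 2) * ∏ k : {k // k ∉ L}, erfG (w k / √A * a)) 0 hA'
    rw [mul_zero, smul_eq_mul] at hsub
    have hprod : ∀ s, ∏ k ∈ Lᶜ, erfG (w k * s) =
        ∏ k : {k // k ∉ L}, erfG (w k / √A * (√A * s)) := by
      intro s
      rw [Finset.prod_subtype (F := inferInstance) Lᶜ (p := fun k => k ∉ L) (by simp)]
      refine Finset.prod_congr rfl fun k _ => ?_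
      congr 1
      field_simp
    have hexp : ∀ s, -A * s ^ 2 = -(√A * s) ^ 2 := by
      intro s; rw [mul_pow, Real.sq_sqrt hA.le]; ring
    simp_rw [hprod, hexp]
    rw [hsub, Real.sqrt_div hA.le]
    field_simp
  -- The image of the wedge axis is a nonzero normal vector.
  · refine ⟨normalSpanMap w L σ (WithLp.toLp 2 (1, 0)),
      (normalSpanMap_mem_cone_iff hw hL _).2 ⟨zero_le_one, fun k => ?_⟩, fun h => ?_⟩
    · show |(0 : ℝ)| ≤ w k / √A * 1
      rw [abs_zero, mul_one]
      exact (div_pos (hw k) hA').le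
    · have h1 := norm_normalSpanMap (σ := σ) hw hL (WithLp.toLp 2 (1, 0))
      rw [h, norm_zero] at h1
      have h2 := congrArg WithLp.fst (norm_eq_zero.1 h1.symm)
      exact one_ne_zero h2

end Polytope

/-! ### Two weights and the decay exponent -/

lemma twoWeights_pos {n : ℕ} (K₁ : Finset (Fin n)) {W : ℝ} (hW : 0 < W) (k : Fin n) :
    0 < twoWeights K₁ W k := by
  unfold twoWeights; split_ifs <;> simp [hW]

lemma externalAngle_twoWeights {n : ℕ} (K₁ L : Finset (Fin n)) (σ : Fin n → ℤˣ) {W : ℝ}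
    (hW : 0 < W) (hL : L.Nonempty) :
    externalAngle (skewedFace (twoWeights K₁ W) L σ) (skewedCrossPolytope (twoWeights K₁ W)) =
      gaussianErfIntegral ((L ∩ K₁).card + W ^ 2 * (L ∩ K₁ᶜ).card) W
        (K₁ \ L).card (K₁ᶜ \ L).card := by
  rw [externalAngle_skewedFace (twoWeights_pos K₁ hW) hL, gaussianErfIntegral]
  have hA : ∑ i ∈ L, twoWeights K₁ W i ^ 2 = (L ∩ K₁).card + W ^ 2 * (L ∩ K₁ᶜ).card := by
    simp only [twoWeights, ite_pow, one_pow]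
    rw [Finset.sum_ite, Finset.sum_const, Finset.sum_const, Finset.filter_mem_eq_inter,
      ← Finset.sdiff_eq_filter, Finset.sdiff_eq_inter_compl]
    simp [mul_comm]
  have hG : ∀ s, ∏ k ∈ Lᶜ, erfG (twoWeights K₁ W k * s) =
      erfG s ^ (K₁ \ L).card * erfG (W * s) ^ (K₁ᶜ \ L).card := by
    intro s
    simp only [twoWeights, ite_mul, one_mul, apply_ite erfG]
    rw [Finset.prod_ite, Finset.prod_const, Finset.prod_const, Finset.filter_mem_eq_inter,
      ← Finset.sdiff_eq_filter, Finset.sdiff_eq_inter_compl, Finset.sdiff_eq_inter_compl,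
      Finset.sdiff_eq_inter_compl, Finset.inter_comm K₁, Finset.inter_comm K₁ᶜ]
  simp_rw [hA, hG]

theorem theorem1
    (γ₁ γ₂ P₁ P₂ t₁ t₂ W C D₁ D₂ : ℝ)
    (hγ₁ : 0 ≤ γ₁) (hγ₂ : 0 ≤ γ₂) (hγ : γ₁ + γ₂ = 1)
    (hP₁ : P₁ ∈ Set.Icc (0 : ℝ) 1) (hP₂ : P₂ ∈ Set.Icc (0 : ℝ) 1)
    (ht₁ : t₁ ∈ Set.Icc 0 (γ₁ * (1 - P₁))) (ht₂ : t₂ ∈ Set.Icc 0 (γ₂ * (1 - P₂)))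
    (hW : 0 < W)
    (hC : C = (t₁ + γ₁ * P₁) + W ^ 2 * (t₂ + γ₂ * P₂))
    (hD₁ : D₁ = γ₁ * (1 - P₁) - t₁) (hD₂ : D₂ = γ₂ * (1 - P₂) - t₂)
    -- the faces are not asymptotically empty, and not asymptotically facets
    (hCpos : 0 < C) (hDpos : 0 < D₁ + D₂) :
    ∃ x₀ : ℝ, 0 < x₀ ∧
      (∀ x : ℝ, 0 < x →
        (2 * C - erfDensity x * D₁ / (x * erfG x)
          - W * erfDensity (W * x) * D₂ / (x * erfG (W * x)) = 0 ↔ x = x₀)) ∧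
      -- every sequence of dimensions `n j → ∞`, index sets `K₁ j` (with complement `K₂ j`),
      -- and faces with support `L j` and signs `σ j`, in the proportions given above
      ∀ (n : ℕ → ℕ) (K₁ L : ∀ j, Finset (Fin (n j))) (σ : ∀ j, Fin (n j) → ℤˣ),
        Tendsto n atTop atTop →
        Tendsto (fun j => ((K₁ j).card : ℝ) / n j) atTop (𝓝 γ₁) →
        Tendsto (fun j => ((L j ∩ K₁ j).card - (K₁ j).card * P₁) / n j) atTop (𝓝 t₁) →
        Tendsto (fun j => ((L j ∩ (K₁ j)ᶜ).card - ((K₁ j)ᶜ.card : ℝ) * P₂) / n j)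
          atTop (𝓝 t₂) →
        Tendsto
          (fun j => -(Real.log (externalAngle
              (skewedFace (twoWeights (K₁ j) W) (L j) (σ j))
              (skewedCrossPolytope (twoWeights (K₁ j) W))) / n j))
          atTop
          (𝓝 (C * x₀ ^ 2 - D₁ * Real.log (erfG x₀) - D₂ * Real.log (erfG (W * x₀)))) := by
  have h₁ : 0 ≤ D₁ := by rw [hD₁]; linarith [ht₁.2]
  have h₂ : 0 ≤ D₂ := by rw [hD₂]; linarith [ht₂.2]
  obtain ⟨x₀, hx₀, hx₀eq⟩ :=
    exists_saddleRatio_eq (c := 2 * C) hW h₁ h₂ hDpos (by positivity)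
  refine ⟨x₀, hx₀, fun x hx => ?_, ?_⟩
  · have hG := erfG_pos hx
    have hG' := erfG_pos (mul_pos hW hx)
    have hrw : 2 * C - erfDensity x * D₁ / (x * erfG x)
        - W * erfDensity (W * x) * D₂ / (x * erfG (W * x)) = 2 * C - saddleRatio D₁ D₂ W x := by
      unfold saddleRatio erfRatio
      field_simp
      ring
    rw [hrw, sub_eq_zero, ← hx₀eq]
    exact ⟨fun h => (saddleRatio_strictAntiOn hW h₁ h₂ hDpos).injOn hx hx₀ h.symm,
      fun h => by rw [h]⟩
  · intro n K₁ L σ hn hK hL₁ hL₂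
    have hn0 : ∀ᶠ j in atTop, (0 : ℝ) < n j :=
      (tendsto_natCast_atTop_atTop.comp hn).eventually_gt_atTop 0
    have hK₂ : Tendsto (fun j => ((K₁ j)ᶜ.card : ℝ) / n j) atTop (𝓝 γ₂) := by
      have h : Tendsto (fun j => 1 - ((K₁ j).card : ℝ) / n j) atTop (𝓝 γ₂) := by
        have := hK.const_sub 1
        rwa [show 1 - γ₁ = γ₂ by linarith] at this
      refine h.congr' ?_
      filter_upwards [hn0] with j hj
      have hc : ((K₁ j).card : ℝ) + (K₁ j)ᶜ.card = n j := by
        exact_mod_cast (Finset.card_add_card_compl (K₁ j)).trans (Fintype.card_fin _)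
      rw [← hc] at hj ⊢
      field_simp
      ring
    have hm₁ : Tendsto (fun j => ((L j ∩ K₁ j).card : ℝ) / n j) atTop (𝓝 (t₁ + γ₁ * P₁)) := by
      refine (hL₁.add (hK.mul_const P₁)).congr fun j => ?_
      ring
    have hm₂ : Tendsto (fun j => ((L j ∩ (K₁ j)ᶜ).card : ℝ) / n j) atTop
        (𝓝 (t₂ + γ₂ * P₂)) := by
      refine (hL₂.add (hK₂.mul_const P₂)).congr fun j => ?_
      ring
    have hcard : ∀ {m : ℕ} (K M : Finset (Fin m)),
        ((K \ M).card : ℝ) = K.card - (M ∩ K).card := fun K M => by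
      rw [eq_sub_iff_add_eq, Finset.inter_comm]
      exact_mod_cast Finset.card_sdiff_add_card_inter K M
    have hd₁ : Tendsto (fun j => ((K₁ j \ L j).card : ℝ) / n j) atTop (𝓝 D₁) := by
      have h := hK.sub hm₁
      rw [show γ₁ - (t₁ + γ₁ * P₁) = D₁ by rw [hD₁]; ring] at h
      refine h.congr fun j => ?_
      rw [hcard, sub_div]
    have hd₂ : Tendsto (fun j => (((K₁ j)ᶜ \ L j).card : ℝ) / n j) atTop (𝓝 D₂) := by
      have h := hK₂.sub hm₂
      rw [show γ₂ - (t₂ + γ₂ * P₂) = D₂ by rw [hD₂]; ring] at h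
      refine h.congr fun j => ?_
      rw [hcard, sub_div]
    have hA : Tendsto (fun j => (((L j ∩ K₁ j).card : ℝ) + W ^ 2 * (L j ∩ (K₁ j)ᶜ).card) / n j)
        atTop (𝓝 C) := by
      rw [hC]
      refine (hm₁.add (hm₂.const_mul (W ^ 2))).congr fun j => ?_
      ring
    have hlim := tendsto_log_gaussianErfIntegral hCpos h₁ h₂ hW hx₀
      (fun s hs => erfExponent_le_of_saddleRatio_eq hW h₁ h₂ hDpos hx₀ hx₀eq hs) hn hA hd₁ hd₂
    refine hlim.congr' ?_
    -- Since C > 0, the Gaussian coefficient is eventually positive, which excludes L = ∅ and makes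
    -- the integral formula available.
    filter_upwards [hA.eventually_const_lt hCpos] with j hj
    have hne : (L j).Nonempty := by
      rw [Finset.nonempty_iff_ne_empty]
      intro h0
      simp [h0] at hj
    rw [externalAngle_twoWeights (K₁ j) (L j) (σ j) hW hne]
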